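/- Let $\mathcal A$ be an abelian category with enough projective objects, and let $\mathcal C$ be a full subcategory of $\mathcal A$ which is resolving (it contains all projective objects and is closed under extensions, direct summands and kernels of epimorphisms between its objects) and contravariantly finite (for every object $X$ of $\mathcal A$ there is a morphism $f : Y \to X$ with $Y \in \mathcal C$ through which every morphism $Z \to X$ with $Z \in \mathcal C$ factors). Let $K(\mathcal A)$ be the homotopy category of cochain complexes over $\mathcal A$, and let $K^-(\mathcal C)$, resp. $K^b(\mathcal C)$, be its full subcategory of bounded above, resp. bounded, complexes with all terms in $\mathcal C$. Let $K^{-,\mathcal C,b}(\mathcal C)$ be the full subcategory of those $X^\bullet \in K^-(\mathcal C)$ for which there is $N \in \mathbb Z$ such that $\mathrm H^i \operatorname{Hom}_{\mathcal A}(C, X^\bullet) = 0$ for all $i \le N$ and all $C \in \mathcal C$; it is a triangulated category. Let $K^b_{ac}(\mathcal C)$ be the full subcategory of $K^-(\mathcal C)$ of the complexes that are homotopy equivalent to bounded acyclic complexes with terms in $\mathcal C$. Then $K^b_{ac}(\mathcal C)$ is contained in $K^{-,\mathcal C,b}(\mathcal C)$ and is a thick subcategory of it (a triangulated subcategory closed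 under direct summands), and there is a triangle equivalence $$K^{-,\mathcal C,b}(\mathcal C)/K^b_{ac}(\mathcal C) \;\cong\; D^b(\mathcal A)$$ between the Verdier quotient and the bounded derived category of $\mathcal A$ which fixes the objects of $K^b(\mathcal C)$: the composite $K^b(\mathcal C) \to K^{-,\mathcal C,b}(\mathcal C) \to K^{-,\mathcal C,b}(\mathcal C)/K^b_{ac}(\mathcal C) \cong D^b(\mathcal A)$ is naturally isomorphic to the canonical functor $K^b(\mathcal C) \to D^b(\mathcal A)$. -/

import Mathlib

open CategoryTheory CategoryTheory.Limits CategoryTheory.Pretriangulated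
open scoped ZeroObject

universe w v u

namespace RelDer

section Subcategories

variable {A : Type u} [Category.{v} A]

/-- A full subcategory `C` (given by its class of objects) is contravariantly finite if every
object `X` has a right `C`-approximation, i.e. a morphism `f : Y ⟶ X` with `Y` in `C` through
which every morphism from an object of `C` to `X` factors. -/
class IsContravariantlyFinite (C : ObjectProperty A) : Prop where
  exists_approximation (X : A) : ∃ (Y : A) (f : Y ⟶ X), C Y ∧
    ∀ (Z : A) (g : Z ⟶ X), C Z → ∃ h : Z ⟶ Y, h ≫ f = g

/-- A full subcategory of an abelian category is resolving if it contains the projective objects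
and is closed under extensions, direct summands (that is, retracts) and kernels of
epimorphisms between its objects. -/
class IsResolving [Abelian A] (C : ObjectProperty A) : Prop
    extends C.IsClosedUnderExtensions, C.IsStableUnderRetracts where
  prop_of_projective (P : A) [Projective P] : C P
  prop_kernel {X Y : A} (f : X ⟶ Y) [Epi f] : C X → C Y → C (kernel f)

variable [Abelian A]

instance (priority := 100) (C : ObjectProperty A) [IsResolving C] : C.ContainsZero where
  exists_zero := ⟨0, isZero_zero A, IsResolving.prop_of_projective 0⟩

end Subcategories

section HomotopyCategories

variable {A : Type u} [Category.{v} A] [Abelian A]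

variable (A) in
/-- The homotopy category `K(A)` of (cochain) complexes. -/
abbrev K : Type (max u v) := HomotopyCategory A (ComplexShape.up ℤ)

/-- `K^-(C)`, as a full subcategory of `K(A)`: the bounded above complexes with terms in `C`. -/
def kMinus (C : ObjectProperty A) : ObjectProperty (K A) := fun X =>
  (∃ b : ℤ, CochainComplex.IsStrictlyLE X.as b) ∧ ∀ i : ℤ, C (X.as.X i)

/-- `K^b(C)`, as a full subcategory of `K(A)`: the bounded complexes with terms in `C`. -/
def kBounded (C : ObjectProperty A) : ObjectProperty (K A) := fun X =>
  (∃ a : ℤ, CochainComplex.IsStrictlyGE X.as a) ∧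
    (∃ b : ℤ, CochainComplex.IsStrictlyLE X.as b) ∧ ∀ i : ℤ, C (X.as.X i)

/-- The complex of abelian groups `Hom_A(Y, X)`, for an object `Y` and a complex `X`. -/
abbrev homComplex (Y : A) (X : CochainComplex A ℤ) : CochainComplex AddCommGrpCat.{v} ℤ :=
  ((preadditiveCoyoneda.obj (Opposite.op Y)).mapHomologicalComplex _).obj X

/-- There is an integer `N` such that `H^i Hom_A(Y, X) = 0` for all `i ≤ N` and all `Y` in `C`. -/
def homBounded (C : ObjectProperty A) : ObjectProperty (K A) := fun X =>
  ∃ N : ℤ, ∀ i : ℤ, i ≤ N → ∀ Y : A, C Y → IsZero ((homComplex Y X.as).homology i)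

/-- `K^{-,C,b}(C)`, as a full subcategory of `K(A)`. -/
def kMinusBounded (C : ObjectProperty A) : ObjectProperty (K A) := kMinus C ⊓ homBounded C

/-- `K^b_ac(C)`, as a full subcategory of `K(A)`: the complexes in `K^-(C)` which are homotopy
equivalent to (that is, isomorphic in `K(A)` to) bounded acyclic complexes over `C`. -/
def kBoundedAcyclic (C : ObjectProperty A) : ObjectProperty (K A) :=
  kMinus C ⊓ (kBounded C ⊓ HomotopyCategory.subcategoryAcyclic A).isoClosure

/-- `K^b_ac(C)`, viewed as a full subcategory of `K^{-,C,b}(C)`. -/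
def acyclicIn (C : ObjectProperty A) : ObjectProperty (kMinusBounded C).FullSubcategory :=
  (kBoundedAcyclic C).inverseImage (kMinusBounded C).ι

/-- A full subcategory of a (pre)triangulated category is thick if it is a triangulated
subcategory closed under direct summands (that is, retracts). -/
structure IsThick {T : Type*} [Category* T] [HasZeroObject T] [HasShift T ℤ] [Preadditive T]
    [∀ n : ℤ, (shiftFunctor T n).Additive] [Pretriangulated T] (P : ObjectProperty T) : Prop where
  isTriangulated : P.IsTriangulated
  isStableUnderRetracts : P.IsStableUnderRetracts

/-! The subcategories above are triangulated. -/

lemma isTriangulated_of_mappingCone (P : ObjectProperty (K A))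
    (h₀ : P ((HomotopyCategory.quotient _ _).obj 0))
    (hs : ∀ (X : CochainComplex A ℤ) (n : ℤ), P ((HomotopyCategory.quotient _ _).obj X) →
      P ((HomotopyCategory.quotient _ _).obj (X⟦n⟧)))
    (hc : ∀ (X Y : CochainComplex A ℤ) (f : X ⟶ Y), P ((HomotopyCategory.quotient _ _).obj X) →
      P ((HomotopyCategory.quotient _ _).obj Y) →
      P ((HomotopyCategory.quotient _ _).obj (CochainComplex.mappingCone f))) :
    P.IsTriangulated := by
  have : P.ContainsZero := ⟨⟨_, Functor.map_isZero _ (isZero_zero _), h₀⟩⟩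
  have : P.IsStableUnderShift ℤ :=
    ⟨fun n => ⟨fun X hX => by
      obtain ⟨X : CochainComplex _ _, rfl⟩ := X.quotient_obj_surjective
      rw [ObjectProperty.prop_shift_iff, HomotopyCategory.shift_quotient_obj]
      exact hs X n hX⟩⟩
  have : P.IsTriangulatedClosed₃ := ⟨fun T hT h₁ h₂ => by
    obtain ⟨f : T.obj₁.as ⟶ T.obj₂.as, hf⟩ :=
      (HomotopyCategory.quotient _ _).map_surjective T.mor₁
    exact ⟨_, hc _ _ f h₁ h₂, ⟨Triangle.π₃.mapIso (isoTriangleOfIso₁₂ T _ hT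
      (HomotopyCategory.mappingCone_triangleh_distinguished f)
      (Iso.refl _) (Iso.refl _)
      ((Category.comp_id _).trans (hf.symm.trans (Category.id_comp _).symm)))⟩⟩⟩
  have : P.IsTriangulatedClosed₂ := .of_isTriangulatedClosed₃
  constructor

lemma prop_mappingCone_X (C : ObjectProperty A) [C.IsClosedUnderExtensions]
    [C.IsClosedUnderIsomorphisms] {X Y : CochainComplex A ℤ} (f : X ⟶ Y)
    (hX : ∀ i, C (X.X i)) (hY : ∀ i, C (Y.X i)) (i : ℤ) :
    C ((CochainComplex.mappingCone f).X i) :=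
  C.prop_of_iso (HomologicalComplex.homotopyCofiber.XIsoBiprod f i (i + 1) rfl).symm
    (C.prop_biprod (hX _) (hY _))

lemma isStrictlyLE_mappingCone {X Y : CochainComplex A ℤ} (f : X ⟶ Y) (a b : ℤ)
    [X.IsStrictlyLE a] [Y.IsStrictlyLE b] :
    (CochainComplex.mappingCone f).IsStrictlyLE (max a b) := by
  rw [CochainComplex.isStrictlyLE_iff]
  intro i hi
  rw [CochainComplex.mappingCone.isZero_X_iff]
  exact ⟨X.isZero_of_isStrictlyLE a _ (by lia), Y.isZero_of_isStrictlyLE b _ (by lia)⟩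

instance (C : ObjectProperty A) [C.ContainsZero] [C.IsClosedUnderExtensions]
    [C.IsClosedUnderIsomorphisms] : (kMinus C).IsTriangulated :=
  isTriangulated_of_mappingCone _
    ⟨⟨0, inferInstanceAs (CochainComplex.IsStrictlyLE (0 : CochainComplex A ℤ) 0)⟩,
      fun i => C.prop_of_isZero
        ((HomologicalComplex.eval A (ComplexShape.up ℤ) i).map_isZero (isZero_zero _))⟩
    (by
      rintro X n ⟨⟨b, hb⟩, h⟩
      have : X.IsStrictlyLE b := hb
      exact ⟨⟨b - n, X.isStrictlyLE_shift b n (b - n) (by lia)⟩, fun i => h _⟩)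
    (by
      rintro X Y f ⟨⟨b, hb⟩, h⟩ ⟨⟨b', hb'⟩, h'⟩
      have : X.IsStrictlyLE b := hb
      have : Y.IsStrictlyLE b' := hb'
      exact ⟨⟨_, isStrictlyLE_mappingCone f b b'⟩, prop_mappingCone_X C f h h'⟩)

instance (C : ObjectProperty A) [C.ContainsZero] [C.IsClosedUnderExtensions]
    [C.IsClosedUnderIsomorphisms] : (kBounded C).IsTriangulated :=
  isTriangulated_of_mappingCone _
    ⟨⟨0, inferInstanceAs (CochainComplex.IsStrictlyGE (0 : CochainComplex A ℤ) 0)⟩,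
      ⟨0, inferInstanceAs (CochainComplex.IsStrictlyLE (0 : CochainComplex A ℤ) 0)⟩,
      fun i => C.prop_of_isZero
        ((HomologicalComplex.eval A (ComplexShape.up ℤ) i).map_isZero (isZero_zero _))⟩
    (by
      rintro X n ⟨⟨a, ha⟩, ⟨b, hb⟩, h⟩
      have : X.IsStrictlyGE a := ha
      have : X.IsStrictlyLE b := hb
      exact ⟨⟨a - n, X.isStrictlyGE_shift a n (a - n) (by lia)⟩,
        ⟨b - n, X.isStrictlyLE_shift b n (b - n) (by lia)⟩, fun i => h _⟩)
    (by
      rintro X Y f ⟨⟨a, ha⟩, ⟨b, hb⟩, h⟩ ⟨⟨a', ha'⟩, ⟨b', hb'⟩, h'⟩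
      have : X.IsStrictlyGE a := ha
      have : X.IsStrictlyLE b := hb
      have : Y.IsStrictlyGE a' := ha'
      have : Y.IsStrictlyLE b' := hb'
      exact ⟨⟨min (a - 1) a', CochainComplex.isStrictlyGE_mappingCone f a a' _⟩,
        ⟨_, isStrictlyLE_mappingCone f b b'⟩, prop_mappingCone_X C f h h'⟩)

/-- The functor `X ↦ H^i Hom_A(Y, X)` on `K(A)`. -/
noncomputable abbrev homCohomology (Y : A) (i : ℤ) : K A ⥤ AddCommGrpCat.{v} :=
  (preadditiveCoyoneda.obj (Opposite.op Y)).mapHomotopyCategory (ComplexShape.up ℤ) ⋙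
    HomotopyCategory.homologyFunctor AddCommGrpCat.{v} (ComplexShape.up ℤ) i

lemma homBounded_iff (C : ObjectProperty A) (X : K A) :
    homBounded C X ↔
      ∃ N : ℤ, ∀ i : ℤ, i ≤ N → ∀ Y : A, C Y → IsZero ((homCohomology Y i).obj X) := by
  have (Y : A) (i : ℤ) : IsZero ((homCohomology Y i).obj X) ↔
      IsZero ((homComplex Y X.as).homology i) :=
    ((HomotopyCategory.homologyFunctorFactors AddCommGrpCat.{v} (ComplexShape.up ℤ) i).app
      (homComplex Y X.as)).isZero_iff
  simp only [this]
  rfl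

instance (C : ObjectProperty A) : (homBounded C).IsClosedUnderIsomorphisms where
  of_iso e h := by
    rw [homBounded_iff] at h ⊢
    obtain ⟨N, hN⟩ := h
    exact ⟨N, fun i hi Y hY => (hN i hi Y hY).of_iso ((homCohomology Y i).mapIso e.symm)⟩

instance (C : ObjectProperty A) : (homBounded C).IsTriangulated where
  exists_zero := ⟨_, isZero_zero _, by
    rw [homBounded_iff]
    exact ⟨0, fun i _ Y _ => Functor.map_isZero _ (isZero_zero _)⟩⟩
  isStableUnderShiftBy n := ⟨fun X hX => by
    rw [ObjectProperty.prop_shift_iff]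
    rw [homBounded_iff] at hX ⊢
    obtain ⟨N, hN⟩ := hX
    refine ⟨N - n, fun i hi Y hY => (hN (n + i) (by lia) Y hY).of_iso ?_⟩
    exact (HomotopyCategory.homologyFunctor AddCommGrpCat.{v} (ComplexShape.up ℤ) i).mapIso
        ((((preadditiveCoyoneda.obj (Opposite.op Y)).mapHomotopyCategory
          (ComplexShape.up ℤ)).commShiftIso n).app X) ≪≫
      ((HomotopyCategory.homologyFunctor AddCommGrpCat.{v} (ComplexShape.up ℤ) 0).shiftIso
        n i (n + i) rfl).app _⟩
  toIsTriangulatedClosed₂ := .mk' (fun T hT h₁ h₃ => by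
    rw [homBounded_iff] at h₁ h₃ ⊢
    obtain ⟨N₁, h₁⟩ := h₁
    obtain ⟨N₃, h₃⟩ := h₃
    exact ⟨min N₁ N₃, fun i hi Y hY =>
      ((homCohomology Y i).map_distinguished_exact T hT).isZero_of_both_zeros
        ((h₁ i (by lia) Y hY).eq_of_src _ _) ((h₃ i (by lia) Y hY).eq_of_tgt _ _)⟩)

instance (C : ObjectProperty A) [C.ContainsZero] [C.IsClosedUnderExtensions]
    [C.IsClosedUnderIsomorphisms] : (kMinusBounded C).IsTriangulated :=
  inferInstanceAs (kMinus C ⊓ homBounded C).IsTriangulated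

instance (C : ObjectProperty A) [C.ContainsZero] [C.IsClosedUnderExtensions]
    [C.IsClosedUnderIsomorphisms] : (acyclicIn C).IsTriangulated := by
  have : acyclicIn C = (kBounded C ⊓ HomotopyCategory.subcategoryAcyclic A).isoClosure.inverseImage
      (kMinusBounded C).ι := by
    ext X
    exact ⟨fun h => h.2, fun h => ⟨X.property.1, h⟩⟩
  rw [this]
  infer_instance

/-- Bounded complexes over `C` belong to `K^{-,C,b}(C)`. -/
lemma kBounded_le_kMinusBounded (C : ObjectProperty A) : kBounded C ≤ kMinusBounded C := by
  rintro X ⟨⟨a, ha⟩, hb, h⟩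
  refine ⟨⟨hb, h⟩, a - 1, fun i hi Y _ => ?_⟩
  have hz : IsZero (X.as.X i) := CochainComplex.isZero_of_isStrictlyGE X.as a i (by lia)
  refine (HomologicalComplex.exactAt_iff_isZero_homology _ _).1 ?_
  exact ShortComplex.exact_of_isZero_X₂ _
    ((preadditiveCoyoneda.obj (Opposite.op Y)).map_isZero hz)

/-- The inclusion functor from `K^b(C)` to `K^{-,C,b}(C)`. -/
abbrev kBoundedInclusion (C : ObjectProperty A) :
    (kBounded C).FullSubcategory ⥤ (kMinusBounded C).FullSubcategory :=
  ObjectProperty.ιOfLE (kBounded_le_kMinusBounded C)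

/-- The Verdier quotient `K^{-,C,b}(C) / K^b_ac(C)`: the localization of `K^{-,C,b}(C)` at the
morphisms whose cone belongs to `K^b_ac(C)`. -/
abbrev RelQuotient (C : ObjectProperty A) [C.ContainsZero] [C.IsClosedUnderExtensions]
    [C.IsClosedUnderIsomorphisms] : Type (max u v) :=
  (acyclicIn C).trW.Localization

/-- The Verdier quotient functor `K^{-,C,b}(C) ⥤ K^{-,C,b}(C) / K^b_ac(C)`. -/
abbrev relQuotientFunctor (C : ObjectProperty A) [C.ContainsZero] [C.IsClosedUnderExtensions]
    [C.IsClosedUnderIsomorphisms] : (kMinusBounded C).FullSubcategory ⥤ RelQuotient C :=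
  (acyclicIn C).trW.Q

end HomotopyCategories

end RelDer

/-! Call a complex relatively acyclic if `Hom(Y, -)` makes it acyclic for every `Y` in `C`. As `C`
contains the projectives, such a complex is acyclic, so a morphism with relatively acyclic cone
becomes invertible in the derived category.

Three facts carry the proof. `K^-(C)` is left orthogonal to relatively acyclic complexes
(`kMinus_le_leftOrthogonal`), so its maps lift along morphisms with relatively acyclic cone. For `X`
in `K^{-,C,b}(C)` and `m` small, `X ⟶ X.truncGE m` is such a morphism (`relAcyclic_trW_πTruncGE`).
Every bounded complex receives such a morphism from an object of `K^{-,C,b}(C)`, built from iterated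
`C`-approximations (`exists_resolution`).

Truncation gives boundedness in the derived category and identifies `K^b_ac(C)` with the acyclic
objects of `K^{-,C,b}(C)`. Resolutions give essential surjectivity. Together with lifting they write
derived morphisms as fractions inside `K^{-,C,b}(C)`, whence fullness and faithfulness. -/

namespace RelDer

/-! ### Relatively acyclic complexes and their triangulated structure. -/

section RelativeAcyclicity

variable {A : Type u} [Category.{v} A] [Abelian A]

/-- The complex `Hom(Y, X)` is exact in degree `i`. -/
def HomExactAt (Y : A) (X : CochainComplex A ℤ) (i : ℤ) : Prop :=
  ∀ x : Y ⟶ X.X i, x ≫ X.d i (i + 1) = 0 → ∃ y : Y ⟶ X.X (i - 1), y ≫ X.d (i - 1) i = x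

lemma homComplex_exactAt_iff (Y : A) (X : CochainComplex A ℤ) (i : ℤ) :
    (homComplex Y X).ExactAt i ↔ HomExactAt Y X i := by
  rw [HomologicalComplex.exactAt_iff' _ (i - 1) i (i + 1) (by simp) (by simp),
    ShortComplex.ab_exact_iff]
  rfl

lemma isZero_homComplex_homology_iff (Y : A) (X : CochainComplex A ℤ) (i : ℤ) :
    IsZero ((homComplex Y X).homology i) ↔ HomExactAt Y X i := by
  rw [← HomologicalComplex.exactAt_iff_isZero_homology, homComplex_exactAt_iff]

lemma HomExactAt.exists_of_eq {Y : A} {X : CochainComplex A ℤ} {j : ℤ} (h : HomExactAt Y X j)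
    {i k : ℤ} (hi : i + 1 = j) (hk : j + 1 = k) (x : Y ⟶ X.X j) (hx : x ≫ X.d j k = 0) :
    ∃ y : Y ⟶ X.X i, y ≫ X.d i j = x := by
  subst hk
  obtain rfl : i = j - 1 := by lia
  exact h x hx

/-- Exactness may be tested after an epimorphic refinement, and a projective cover of the source of
a cocycle is one. -/
lemma exactAt_of_homExactAt [EnoughProjectives A] (X : CochainComplex A ℤ) (i : ℤ)
    (h : ∀ (P : A) [Projective P], HomExactAt P X i) : X.ExactAt i := by
  rw [HomologicalComplex.exactAt_iff' _ (i - 1) i (i + 1) (by simp) (by simp),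
    ShortComplex.exact_iff_exact_up_to_refinements]
  intro Y (x : Y ⟶ X.X i) (hx : x ≫ X.d i (i + 1) = 0)
  obtain ⟨y, hy⟩ := h (Projective.over Y) (Projective.π Y ≫ x)
    (by rw [Category.assoc, hx, comp_zero])
  exact ⟨_, Projective.π Y, inferInstance, y, hy.symm⟩

/-- The functor `X ↦ Hom(Y, X)` between homotopy categories. -/
noncomputable abbrev homFunctor (Y : A) : K A ⥤ K AddCommGrpCat.{v} :=
  (preadditiveCoyoneda.obj (Opposite.op Y)).mapHomotopyCategory (ComplexShape.up ℤ)

/-- The complexes `X` such that `Hom(Y, X)` is acyclic for all `Y` in `C`. -/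
def relAcyclic (C : ObjectProperty A) : ObjectProperty (K A) := fun X =>
  ∀ Y, C Y → HomotopyCategory.subcategoryAcyclic AddCommGrpCat.{v} ((homFunctor Y).obj X)

variable (C : ObjectProperty A)

lemma relAcyclic_quotient_obj_iff (X : CochainComplex A ℤ) :
    relAcyclic C ((HomotopyCategory.quotient _ _).obj X) ↔
      ∀ Y, C Y → ∀ i, HomExactAt Y X i := by
  refine forall_congr' fun Y => forall_congr' fun _ => ?_
  simp only [← homComplex_exactAt_iff]
  exact HomotopyCategory.quotient_obj_mem_subcategoryAcyclic_iff_exactAt (homComplex Y X)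

instance : (relAcyclic C).IsClosedUnderIsomorphisms where
  of_iso e h _ hY := ObjectProperty.prop_of_iso _ ((homFunctor _).mapIso e) (h _ hY)

instance : (relAcyclic C).IsTriangulated where
  exists_zero := ⟨_, isZero_zero _, fun _ _ =>
    ObjectProperty.prop_of_isZero _ (Functor.map_isZero _ (isZero_zero _))⟩
  isStableUnderShiftBy n := ⟨fun X hX Y hY => ObjectProperty.prop_of_iso _
    (((homFunctor Y).commShiftIso n).symm.app X) (ObjectProperty.le_shift _ n _ (hX Y hY))⟩
  toIsTriangulatedClosed₂ := .mk' fun T hT h₁ h₃ _ hY =>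
    ObjectProperty.ext_of_isTriangulatedClosed₂ _ _ ((homFunctor _).map_distinguished T hT)
      (h₁ _ hY) (h₃ _ hY)

/-- `Hom(Y, -)` is triangulated, so it sends the cone of `f` to the cone of its image. -/
lemma relAcyclic_trW_iff {X X' : K A} (f : X ⟶ X') :
    (relAcyclic C).trW f ↔
      ∀ Y, C Y → HomotopyCategory.quasiIso _ (ComplexShape.up ℤ) ((homFunctor Y).map f) := by
  obtain ⟨Z, g, h, hT⟩ := distinguished_cocone_triangle f
  refine ((relAcyclic C).trW_iff_of_distinguished _ hT).trans
    (forall_congr' fun Y => forall_congr' fun hY => ?_)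
  rw [HomotopyCategory.quasiIso_eq_trW_subcategoryAcyclic]
  exact ((HomotopyCategory.subcategoryAcyclic _).trW_iff_of_distinguished _
    ((homFunctor Y).map_distinguished _ hT)).symm

lemma relAcyclic_trW_quotient_map_iff {X X' : CochainComplex A ℤ} (f : X ⟶ X') :
    (relAcyclic C).trW ((HomotopyCategory.quotient _ _).map f) ↔ ∀ Y, C Y →
      QuasiIso (((preadditiveCoyoneda.obj (Opposite.op Y)).mapHomologicalComplex _).map f) := by
  rw [relAcyclic_trW_iff]
  refine forall_congr' fun Y => forall_congr' fun _ => ?_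
  rw [← HomologicalComplex.mem_quasiIso_iff, ← HomotopyCategory.quotient_map_mem_quasiIso_iff]
  rfl

lemma relAcyclic_le_subcategoryAcyclic [EnoughProjectives A] [IsResolving C] :
    relAcyclic C ≤ HomotopyCategory.subcategoryAcyclic A := by
  intro X hX
  obtain ⟨X, rfl⟩ := HomotopyCategory.quotient_obj_surjective X
  rw [HomotopyCategory.quotient_obj_mem_subcategoryAcyclic_iff_exactAt]
  rw [relAcyclic_quotient_obj_iff] at hX
  exact fun i => exactAt_of_homExactAt X i fun P _ =>
    hX P (IsResolving.prop_of_projective P) i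

end RelativeAcyclicity

/-! ### Null-homotopies, orthogonality and lifting. -/

section Lifting

section Homotopy

open CochainComplex CochainComplex.HomComplex

variable {B : Type*} [Category* B] [Abelian B]

/-- The defect `u` of the homotopy equation in degree `n + 1` is killed by the incoming
differential, so `h` factors it through the outgoing one. The correction has source `K.X (n + 2)`
and leaves degrees up to `n` untouched. -/
lemma exists_eqUpTo_succ {K L : CochainComplex B ℤ}
    (f : K ⟶ L) (α : Cochain K L (-1)) (n m : ℤ) (hnm : n + 1 = m)
    (h : ∀ u : K.X (n + 1) ⟶ L.X (n + 1), K.d n (n + 1) ≫ u = 0 →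
      ∃ β : K.X (n + 2) ⟶ L.X (n + 1), K.d (n + 1) (n + 2) ≫ β = u)
    (hα : (δ (-1) 0 α).EqUpTo (Cochain.ofHom f) n) :
    ∃ (β : K.X (n + 2) ⟶ L.X (n + 1)),
      (δ (-1) 0 (α + Cochain.single β (-1))).EqUpTo (Cochain.ofHom f) m := by
  subst hnm
  let u := f.f (n + 1) - α.v (n + 1) n (by lia) ≫ L.d n (n + 1) -
    K.d (n + 1) (n + 2) ≫ α.v (n + 2) (n + 1) (by lia)
  have hu : K.d n (n + 1) ≫ u = 0 := by
    have eq := hα n n (add_zero n) (by rfl)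
    simp only [δ_v (-1) 0 (neg_add_cancel 1) α n n (add_zero _) (n - 1) (n + 1)
      (by lia) (by lia), Int.negOnePow_zero, one_smul, Cochain.ofHom_v] at eq
    simp only [u, Preadditive.comp_sub, HomologicalComplex.d_comp_d_assoc, zero_comp,
      ← f.comm, ← eq, Preadditive.add_comp, Category.assoc, L.d_comp_d, comp_zero, zero_add,
      sub_self]
  obtain ⟨β, hβ⟩ := h u hu
  refine ⟨β, fun p q hpq hp => ?_⟩
  obtain rfl : p = q := by lia
  obtain hp | rfl := hp.lt_or_eq
  · rw [δ_add, Cochain.add_v, hα p p (by lia) (by lia), add_eq_left,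
      δ_v (-1) 0 (neg_add_cancel 1) _ p p hpq (p - 1) (p + 1) rfl rfl,
      Cochain.single_v_eq_zero _ _ _ _ _ (by lia),
      Cochain.single_v_eq_zero _ _ _ _ _ (by lia)]
    simp
  · rw [δ_v (-1) 0 (neg_add_cancel 1) _ (n + 1) (n + 1) (by lia) n (n + 2)
      (by lia) (by lia), Cochain.add_v,
      Cochain.single_v_eq_zero _ _ _ _ _ (by lia)]
    simp [hβ, u]

open Cochain.InductionUp in
/-- A morphism `f : K ⟶ L` to a bounded below complex is homotopic to zero if the complexes
`Hom(K, L.X n)` are acyclic. -/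
lemma nonempty_homotopy_zero_of_isStrictlyGE {K L : CochainComplex B ℤ} (d : ℤ)
    [L.IsStrictlyGE d] (f : K ⟶ L)
    (h : ∀ (n : ℤ) (u : K.X (n + 1) ⟶ L.X (n + 1)), K.d n (n + 1) ≫ u = 0 →
      ∃ β : K.X (n + 2) ⟶ L.X (n + 1), K.d (n + 1) (n + 2) ≫ β = u) :
    Nonempty (Homotopy f 0) := by
  let X (n : ℕ) : Set (Cochain K L (-1)) :=
    Set.ofPred (fun α => (δ (-1) 0 α).EqUpTo (Cochain.ofHom f) (n + d - 1))
  -- The zero cochain works through degree `d - 1`, where `L` vanishes.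
  let x₀ : X 0 := ⟨0, fun p q hpq hp ↦
    IsZero.eq_of_tgt (L.isZero_of_isStrictlyGE d _ (by lia)) _ _⟩
  let φ (n : ℕ) (α : X n) : X (n + 1) :=
    ⟨_, (exists_eqUpTo_succ f α.1 (n + d - 1) ((n + 1 : ℕ) + d - 1)
      (by lia) (h _) α.2).choose_spec⟩
  have hφ (k : ℕ) (x : X k) : (φ k x).1.EqUpTo x.1 (d + k) := fun p q hpq hp => by
    dsimp [φ]
    rw [add_eq_left, Cochain.single_v_eq_zero _ _ _ _ _ (by lia)]
  refine ⟨(Cochain.equivHomotopy f 0).symm ⟨limitSequence φ hφ x₀, ?_⟩⟩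
  rw [Cochain.ofHom_zero, add_zero]
  ext n
  -- Stage `k₀` solves the equation in degree `n`, and later stages no longer change the two
  -- components occurring there.
  let k₀ := (n - d + 1).toNat
  rw [← (sequence φ x₀ k₀).2 n n (add_zero n) (by lia),
    δ_v (-1) 0 (neg_add_cancel 1) _ n n (by lia) (n - 1) (n + 1) rfl (by lia),
    δ_v (-1) 0 (neg_add_cancel 1) _ n n (by lia) (n - 1) (n + 1) rfl (by lia),
    limitSequence_eqUpTo φ hφ x₀ k₀ n (n - 1) (by lia) (by lia),
    limitSequence_eqUpTo φ hφ x₀ k₀ (n + 1) n (by lia) (by lia)]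

end Homotopy

variable {A : Type u} [Category.{v} A] [Abelian A]

/-- Dual of the previous lemma: in the opposite category, with degrees negated, `R` becomes a
bounded below target. -/
lemma nonempty_homotopy_zero_of_isStrictlyLE {R W : CochainComplex A ℤ} (d : ℤ)
    [R.IsStrictlyLE d] (f : R ⟶ W) (h : ∀ i, HomExactAt (R.X i) W i) :
    Nonempty (Homotopy f 0) := by
  let F := (CochainComplex.opEquivalence A).functor
  have : (F.obj (Opposite.op R)).IsStrictlyGE (-d) := by
    rw [CochainComplex.isStrictlyGE_iff]
    intro i hi
    exact (R.isZero_of_isStrictlyLE d (-i) (by lia)).op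
  obtain ⟨H⟩ := nonempty_homotopy_zero_of_isStrictlyGE (-d) (F.map f.op) (fun n u hu => by
    obtain ⟨y, hy⟩ := (h (-(n + 1))).exists_of_eq (i := -(n + 2)) (k := -n) (by lia) (by lia)
      u.unop (Quiver.Hom.op_inj hu)
    exact ⟨y.op, Quiver.Hom.unop_inj hy⟩)
  exact ⟨CochainComplex.homotopyUnop (H.trans (.ofEq (by simp [F])))⟩

variable (C : ObjectProperty A)

lemma kMinus_le_leftOrthogonal : kMinus C ≤ (relAcyclic C).leftOrthogonal := by
  intro R hR W f hW
  obtain ⟨R, rfl⟩ := HomotopyCategory.quotient_obj_surjective R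
  obtain ⟨W, rfl⟩ := HomotopyCategory.quotient_obj_surjective W
  obtain ⟨f, rfl⟩ := (HomotopyCategory.quotient _ _).map_surjective f
  obtain ⟨⟨b, hb⟩, hR⟩ := hR
  rw [relAcyclic_quotient_obj_iff] at hW
  have : CochainComplex.IsStrictlyLE R b := hb
  obtain ⟨H⟩ := nonempty_homotopy_zero_of_isStrictlyLE b f fun i => hW _ (hR i) i
  rw [HomotopyCategory.eq_of_homotopy _ _ H, Functor.map_zero]

/-- Morphisms from objects of `K^-(C)` lift along morphisms with a relatively acyclic cone. -/
lemma exists_lift {R X X' : K A} (hR : kMinus C R) {s : X ⟶ X'} (hs : (relAcyclic C).trW s)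
    (f : R ⟶ X') : ∃ g : R ⟶ X, g ≫ s = f := by
  have h := kMinus_le_leftOrthogonal C _ hR
  rw [← ObjectProperty.isColocal_trW] at h
  exact (h s hs).surjective f

lemma isIso_of_relAcyclic_trW [C.ContainsZero] [C.IsClosedUnderExtensions]
    [C.IsClosedUnderIsomorphisms] {X X' : K A} (hX : kMinus C X) (hX' : kMinus C X')
    {s : X ⟶ X'} (hs : (relAcyclic C).trW s) : IsIso s := by
  obtain ⟨Z, g, h, hT, hZ⟩ := hs
  obtain ⟨Z', hZ', ⟨e⟩⟩ := (kMinus C).ext_of_isTriangulatedClosed₃' _ hT hX hX'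
  -- The cone is relatively acyclic and isomorphic to an object of `K^-(C)`, hence orthogonal to
  -- itself.
  have : IsZero Z := by
    have : e.inv = 0 := kMinus_le_leftOrthogonal C _ hZ' _ hZ
    rw [IsZero.iff_id_eq_zero]
    exact e.hom_inv_id.symm.trans (by rw [this]; exact comp_zero)
  exact (Triangle.isZero₃_iff_isIso₁ _ hT).1 this

end Lifting

/-! ### Canonical truncations of complexes over `C`. -/

section Truncation

variable {A : Type u} [Category.{v} A] [Abelian A] (C : ObjectProperty A)

lemma isIso_πTruncGE_f (X : CochainComplex A ℤ) (m i : ℤ) (hi : m < i) :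
    IsIso ((X.πTruncGE m).f i) := by
  obtain ⟨k, hk⟩ := Int.le.dest hi.le
  have hk' : (ComplexShape.embeddingUpIntGE m).f k = i := hk
  have hb : ¬ (ComplexShape.embeddingUpIntGE m).BoundaryGE k := by
    rw [ComplexShape.boundaryGE_embeddingUpIntGE_iff]
    lia
  exact ((ComplexShape.embeddingUpIntGE m).isIso_liftExtend_f_iff _
    (HomologicalComplex.restrictionToTruncGE'_hasLift X _) hk').2
    (X.isIso_restrictionToTruncGE' _ k hb)

lemma quasiIsoAt_of_isIso_f {V : Type*} [Category* V] [Abelian V] {X Y : CochainComplex V ℤ}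
    (f : X ⟶ Y) (i : ℤ) (h₁ : IsIso (f.f (i - 1))) (h₂ : IsIso (f.f i))
    (h₃ : IsIso (f.f (i + 1))) : QuasiIsoAt f i := by
  rw [quasiIsoAt_iff' f (i - 1) i (i + 1) (by simp) (by simp)]
  have : IsIso ((HomologicalComplex.shortComplexFunctor' V _ (i - 1) i (i + 1)).map f) :=
    (ShortComplex.isIso_iff _).2 ⟨h₁, h₂, h₃⟩
  infer_instance

lemma homExactAt_of_isZero (Y : A) (X : CochainComplex A ℤ) (i : ℤ) (h : IsZero (X.X i)) :
    HomExactAt Y X i :=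
  fun _ _ => ⟨0, h.eq_of_tgt _ _⟩

lemma mono_d_of_isStrictlyGE (X : CochainComplex A ℤ) (i : ℤ) [X.IsStrictlyGE i]
    (h : X.ExactAt i) : Mono (X.d i (i + 1)) := by
  rw [HomologicalComplex.exactAt_iff' _ (i - 1) i (i + 1) (by simp) (by simp)] at h
  exact h.mono_g ((X.isZero_of_isStrictlyGE i (i - 1)).eq_of_src (X.d _ _) 0)

lemma homBounded_quotient_obj_iff (X : CochainComplex A ℤ) :
    homBounded C ((HomotopyCategory.quotient _ _).obj X) ↔
      ∃ N : ℤ, ∀ i ≤ N, ∀ Y, C Y → HomExactAt Y X i := by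
  simp only [← isZero_homComplex_homology_iff]
  rfl

variable [IsResolving C]

/-- In an exact bounded above complex with terms in `C`, the cycles are in `C`. -/
lemma prop_kernel_d (X : CochainComplex A ℤ) (b m : ℤ) [X.IsStrictlyLE b]
    (hX : ∀ i, m < i → C (X.X i)) (hex : ∀ i, m < i → X.ExactAt i) (i j : ℤ)
    (hij : i + 1 = j) (hi : m < i) :
    C (kernel (X.d i j)) := by
  subst hij
  -- Descending induction from the top degree: the cycles in degree `i` are the kernel of the
  -- epimorphism from `X.X i` onto the cycles in degree `i + 1`.
  obtain ⟨k, hk⟩ : ∃ k : ℕ, b + 1 - i ≤ k := ⟨(b + 1 - i).toNat, by lia⟩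
  induction k generalizing i with
  | zero =>
    exact C.prop_of_isZero (IsZero.of_mono (kernel.ι (X.d i (i + 1)))
      (X.isZero_of_isStrictlyLE b i (by lia)))
  | succ k hk' =>
    let φ : X.X i ⟶ kernel (X.d (i + 1) (i + 1 + 1)) := kernel.lift _ (X.d i (i + 1)) (by simp)
    have hφ : φ ≫ kernel.ι _ = X.d i (i + 1) := by simp [φ]
    have : Epi φ := by
      have h := hex (i + 1) (by lia)
      rw [HomologicalComplex.exactAt_iff' _ i (i + 1) (i + 1 + 1) (by simp) (by simp)] at h
      exact h.epi_kernelLift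
    refine C.prop_of_iso ?_ (IsResolving.prop_kernel φ (hX i hi) (hk' (i + 1) (by lia) (by lia)))
    exact (kernelCompMono φ (kernel.ι _)).symm ≪≫ kernelIsoOfEq hφ

/-- Only degree `m` is in doubt. There exactness identifies the term with the cycles in degree `m +
1`, and `prop_kernel_d` needs terms in `C` only above `m`. -/
lemma prop_truncGE_X (X : CochainComplex A ℤ) (b m : ℤ) [X.IsStrictlyLE b]
    (hX : ∀ i, C (X.X i)) (hex : X.Acyclic) (i : ℤ) : C ((X.truncGE m).X i) := by
  have h (i : ℤ) (hi : m < i) : C ((X.truncGE m).X i) := by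
    have := isIso_πTruncGE_f X m i hi
    exact C.prop_of_iso (asIso ((X.πTruncGE m).f i)) (hX i)
  obtain hi | rfl | hi := lt_trichotomy i m
  · exact C.prop_of_isZero (CochainComplex.isZero_of_isStrictlyGE _ m i)
  · have hex' : (X.truncGE i).Acyclic := hex.truncGE _
    let φ : (X.truncGE i).X i ⟶ kernel ((X.truncGE i).d (i + 1) (i + 1 + 1)) :=
      kernel.lift _ ((X.truncGE i).d i (i + 1)) (by simp)
    have hφ : φ ≫ kernel.ι _ = (X.truncGE i).d i (i + 1) := by simp [φ]
    have : Epi φ := by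
      have h := hex' (i + 1)
      rw [HomologicalComplex.exactAt_iff' _ i (i + 1) (i + 1 + 1) (by simp) (by simp)] at h
      exact h.epi_kernelLift
    have : Mono φ := by
      have := mono_d_of_isStrictlyGE (X.truncGE i) i (hex' i)
      exact mono_of_mono_fac hφ
    have := isIso_of_mono_of_epi φ
    exact C.prop_of_iso (asIso φ).symm
      (prop_kernel_d C _ b i h (fun i _ => hex' i) (i + 1) _ rfl (by lia))
  · exact h i hi

variable [EnoughProjectives A]

lemma exactAt_of_homExactAt' {X : CochainComplex A ℤ} {i : ℤ}
    (h : ∀ Y, C Y → HomExactAt Y X i) : X.ExactAt i :=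
  exactAt_of_homExactAt X i fun P _ => h P (IsResolving.prop_of_projective P)

/-- Up to degree `m + 1` both Hom complexes are exact: in degree `m` the truncated differential is
mono, and in degree `m + 1` a primitive found in `X` maps to the truncation. Beyond that, the
truncation map is invertible in all neighbouring degrees. -/
lemma relAcyclic_trW_πTruncGE (X : CochainComplex A ℤ) (m : ℤ)
    (h : ∀ i ≤ m + 1, ∀ Y, C Y → HomExactAt Y X i) :
    (relAcyclic C).trW ((HomotopyCategory.quotient _ _).map (X.πTruncGE m)) := by
  rw [relAcyclic_trW_quotient_map_iff]
  intro Y hY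
  refine ⟨fun i => ?_⟩
  by_cases hi : i ≤ m + 1
  · rw [quasiIsoAt_iff_exactAt]
    · refine (homComplex_exactAt_iff Y (X.truncGE m) i).2 ?_
      obtain hi | rfl | rfl : i < m ∨ i = m ∨ i = m + 1 := by lia
      · exact homExactAt_of_isZero _ _ _ (CochainComplex.isZero_of_isStrictlyGE _ m i)
      · have hex : (X.truncGE i).ExactAt i := by
          rw [← exactAt_iff_of_quasiIsoAt (X.πTruncGE i)]
          exact exactAt_of_homExactAt' C (h i (by lia))
        have := mono_d_of_isStrictlyGE (X.truncGE i) i hex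
        intro x hx
        exact ⟨0, by rw [zero_comp, zero_of_comp_mono _ hx]⟩
      · intro x hx
        have := isIso_πTruncGE_f X m (m + 1) (by lia)
        have := isIso_πTruncGE_f X m (m + 1 + 1) (by lia)
        obtain ⟨y, hy⟩ := h (m + 1) (by lia) Y hY (x ≫ inv ((X.πTruncGE m).f (m + 1))) (by
          rw [← cancel_mono ((X.πTruncGE m).f (m + 1 + 1)), Category.assoc, Category.assoc,
            ← (X.πTruncGE m).comm, IsIso.inv_hom_id_assoc, hx, zero_comp])
        refine ⟨y ≫ (X.πTruncGE m).f _, ?_⟩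
        rw [Category.assoc, (X.πTruncGE m).comm, reassoc_of% hy, IsIso.inv_hom_id,
          Category.comp_id]
    · exact (homComplex_exactAt_iff Y X i).2 (h i hi Y hY)
  · have := isIso_πTruncGE_f X m (i - 1) (by lia)
    have := isIso_πTruncGE_f X m i (by lia)
    have := isIso_πTruncGE_f X m (i + 1) (by lia)
    apply quasiIsoAt_of_isIso_f 
    all_goals exact inferInstanceAs (IsIso
      ((preadditiveCoyoneda.obj (Opposite.op Y)).map ((X.πTruncGE m).f _)))

end Truncation

/-! ### Proper resolutions of bounded complexes. -/

section Resolutions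

section Orthogonal

variable {T : Type*} [Category* T] [HasZeroObject T] [HasShift T ℤ] [Preadditive T]
  [∀ n : ℤ, (shiftFunctor T n).Additive] [Pretriangulated T]

/-- Orthogonality kills the connecting morphism, so the triangle splits and the summands can be
exchanged. -/
lemma extensionProduct_le_swap {P Q : ObjectProperty T} [Q.IsStableUnderShift ℤ]
    (h : P ≤ Q.leftOrthogonal) : Q.extensionProduct P ≤ P.extensionProduct Q := by
  rintro X ⟨Y, Z, f, g, k, hT, hY, hZ⟩
  have hk : k = 0 := h _ hZ k (Q.le_shift 1 _ hY)
  obtain ⟨e, -, -⟩ := exists_iso_binaryBiproduct_of_distTriang _ hT hk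
  exact ObjectProperty.prop_of_iso _ ((biprod.braiding Z Y) ≪≫ e.symm)
    ⟨_, _, _, _, _, binaryBiproductTriangle_distinguished Z Y, hZ, hY⟩

/-- If `P` is left orthogonal to `Q`, then the extensions of objects of `Q` by objects of `P`
are closed under extensions. -/
lemma extensionProduct_extensionProduct_le [IsTriangulated T] {P Q : ObjectProperty T}
    [P.IsTriangulatedClosed₂] [Q.IsTriangulatedClosed₂] [Q.IsStableUnderShift ℤ]
    (h : P ≤ Q.leftOrthogonal) :
    (P.extensionProduct Q).extensionProduct (P.extensionProduct Q) ≤ P.extensionProduct Q := by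
  have hP : P.extensionProduct P ≤ P.isoClosure :=
    ObjectProperty.extensionProduct_le_of_isTriangulatedClosed₂' le_rfl le_rfl
  have hQ : Q.extensionProduct Q ≤ Q.isoClosure :=
    ObjectProperty.extensionProduct_le_of_isTriangulatedClosed₂' le_rfl le_rfl
  calc (P.extensionProduct Q).extensionProduct (P.extensionProduct Q)
      = P.extensionProduct ((Q.extensionProduct P).extensionProduct Q) := by
        simp only [ObjectProperty.extensionProduct_assoc]
    _ ≤ P.extensionProduct ((P.extensionProduct Q).extensionProduct Q) :=
        P.monotone_extensionProduct_right
          (ObjectProperty.monotone_extensionProduct_left _ (extensionProduct_le_swap h))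
    _ = (P.extensionProduct P).extensionProduct (Q.extensionProduct Q) := by
        simp only [ObjectProperty.extensionProduct_assoc]
    _ ≤ P.isoClosure.extensionProduct Q.isoClosure :=
        (ObjectProperty.monotone_extensionProduct_left _ hP).trans
          (ObjectProperty.monotone_extensionProduct_right _ hQ)
    _ = P.extensionProduct Q := by
        rw [ObjectProperty.extensionProduct_isoClosure_left,
          ObjectProperty.extensionProduct_isoClosure_right]

end Orthogonal

section Approximation

variable {A : Type u} [Category.{v} A] (C : ObjectProperty A) [IsContravariantlyFinite C]

/-- The source of a chosen right `C`-approximation. -/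
noncomputable def approx (X : A) : A :=
  (IsContravariantlyFinite.exists_approximation (C := C) X).choose

/-- A chosen right `C`-approximation. -/
noncomputable def approxπ (X : A) : approx C X ⟶ X :=
  (IsContravariantlyFinite.exists_approximation (C := C) X).choose_spec.choose

lemma prop_approx (X : A) : C (approx C X) :=
  (IsContravariantlyFinite.exists_approximation (C := C) X).choose_spec.choose_spec.1

lemma exists_comp_approxπ {X Z : A} (hZ : C Z) (g : Z ⟶ X) : ∃ h, h ≫ approxπ C X = g :=
  (IsContravariantlyFinite.exists_approximation (C := C) X).choose_spec.choose_spec.2 Z g hZ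

end Approximation

variable {A : Type u} [Category.{v} A] [Abelian A]

/-- A bounded above complex is an extension of a complex with one degree less by its top term. -/
lemma exists_triangle_single (X : CochainComplex A ℤ) (b : ℤ) [X.IsStrictlyLE b] :
    ∃ (X' : CochainComplex A ℤ)
      (f : (HomotopyCategory.quotient A (.up ℤ)).obj ((HomologicalComplex.single A _ b).obj (X.X b))
        ⟶ (HomotopyCategory.quotient A (.up ℤ)).obj X)
      (g : (HomotopyCategory.quotient A (.up ℤ)).obj X ⟶
        (HomotopyCategory.quotient A (.up ℤ)).obj X') (h : _ ⟶ _),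
      Triangle.mk f g h ∈ distinguishedTriangles ∧ IsZero (X'.X b) ∧
        ∀ i, i ≠ b → Nonempty (X.X i ≅ X'.X i) := by
  let f : (HomologicalComplex.single A _ b).obj (X.X b) ⟶ X :=
    HomologicalComplex.mkHomFromSingle (𝟙 _) (fun k hk =>
      (X.isZero_of_isStrictlyLE b k (by simp at hk; lia)).eq_of_tgt _ _)
  let S := ShortComplex.mk f (cokernel.π f) (cokernel.condition f)
  have hS (n : ℤ) : (S.map (HomologicalComplex.eval A _ n)).Exact :=
    (ShortComplex.exact_cokernel f).map _
  have hepi (n : ℤ) : Epi (S.map (HomologicalComplex.eval A _ n)).g :=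
    inferInstanceAs (Epi ((HomologicalComplex.eval A _ n).map (cokernel.π f)))
  have h₁ (n : ℤ) (hn : n ≠ b) : IsZero (S.map (HomologicalComplex.eval A _ n)).X₁ :=
    HomologicalComplex.isZero_single_obj_X (.up ℤ) _ _ _ hn
  have hg (n : ℤ) (hn : n ≠ b) : IsIso (S.map (HomologicalComplex.eval A _ n)).g := by
    have := (hS n).mono_g ((h₁ n hn).eq_of_src _ _)
    exact isIso_of_mono_of_epi _
  have hf : IsIso (S.map (HomologicalComplex.eval A _ b)).f := by
    change IsIso (f.f b)
    rw [HomologicalComplex.mkHomFromSingle_f]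
    infer_instance
  have h₃ : IsZero (S.map (HomologicalComplex.eval A _ b)).X₃ := by
    rw [IsZero.iff_id_eq_zero, ← cancel_epi (S.map (HomologicalComplex.eval A _ b)).g,
      ← cancel_epi (S.map (HomologicalComplex.eval A _ b)).f, Category.comp_id, comp_zero, comp_zero]
    exact (S.map (HomologicalComplex.eval A _ b)).zero
  -- In every degree one outer term vanishes, so the sequence splits degreewise and gives a triangle
  -- in `K A`.
  have σ (n : ℤ) : Nonempty (S.map (HomologicalComplex.eval A _ n)).Splitting := by
    by_cases hn : n = b
    · subst hn
      exact ⟨.ofIsIsoOfIsZero _ hf h₃⟩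
    · exact ⟨.ofIsZeroOfIsIso _ (h₁ n hn) (hg n hn)⟩
  refine ⟨cokernel f, _, _, _, HomotopyCategory.distinguished_iff_iso_trianglehOfDegreewiseSplit _ |>.2
    ⟨S, fun n => (σ n).some, ⟨Iso.refl _⟩⟩, h₃, fun i hi => ?_⟩
  exact ⟨@asIso _ _ _ _ _ (hg i hi)⟩

section Resolution

variable (C : ObjectProperty A) [IsContravariantlyFinite C]

/-- The proper `C`-resolution of an object `M`, augmented by `M` in degree `0`. -/
noncomputable def augmentedResolution (M : A) : ChainComplex A ℕ :=
  ChainComplex.mk' M (approx C M) (approxπ C M)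
    (fun f => ⟨_, approxπ C (kernel f) ≫ kernel.ι f, by simp⟩)

lemma prop_augmentedResolution_X [C.IsClosedUnderIsomorphisms] (M : A) (n : ℕ) :
    C ((augmentedResolution C M).X (n + 1)) := by
  obtain _ | n := n
  · exact prop_approx C M
  · exact C.prop_of_iso (ChainComplex.mk'XIso _ _ _ _ n).symm (prop_approx C _)

lemma exists_comp_augmentedResolution_d_one_zero {M Y : A} (hY : C Y)
    (x : Y ⟶ (augmentedResolution C M).X 0) :
    ∃ y, y ≫ (augmentedResolution C M).d 1 0 = x := by
  obtain ⟨y, hy⟩ := exists_comp_approxπ C (X := M) hY x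
  refine ⟨y, ?_⟩
  dsimp only [augmentedResolution]
  rw [ChainComplex.mk'_d_1_0]
  exact hy

lemma exists_comp_augmentedResolution_d {M Y : A} (hY : C Y) (n : ℕ)
    (x : Y ⟶ (augmentedResolution C M).X (n + 1))
    (hx : x ≫ (augmentedResolution C M).d (n + 1) n = 0) :
    ∃ y, y ≫ (augmentedResolution C M).d (n + 2) (n + 1) = x := by
  -- A cycle lands in the kernel, and maps from `C` into the kernel lift through its approximation.
  obtain ⟨y, hy⟩ := exists_comp_approxπ C hY (kernel.lift _ x hx)
  obtain ⟨e, he⟩ : ∃ e : (augmentedResolution C M).X (n + 2) ≅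
      approx C (kernel ((augmentedResolution C M).d (n + 1) n)),
      (augmentedResolution C M).d (n + 2) (n + 1) = e.hom ≫ approxπ C _ ≫ kernel.ι _ :=
    ⟨ChainComplex.mk'XIso _ _ _ _ n, ChainComplex.mk'_d _ _ _ _ n⟩
  refine ⟨y ≫ e.inv, ?_⟩
  rw [he, Category.assoc, Iso.inv_hom_id_assoc, reassoc_of% hy, kernel.lift_ι]

lemma exists_relAcyclic_zero [C.IsClosedUnderIsomorphisms] (M : A) :
    ∃ (E : CochainComplex A ℤ), E.IsStrictlyLE 0 ∧
      relAcyclic C ((HomotopyCategory.quotient _ _).obj E) ∧ (∀ i, i < 0 → C (E.X i)) ∧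
        Nonempty (E.X 0 ≅ M) := by
  let e := ComplexShape.embeddingDownNat
  let F := augmentedResolution C M
  have he (n : ℕ) {i : ℤ} (hi : i = -n) : e.f n = i := by rw [hi]; rfl
  refine ⟨F.extend e, inferInstance, ?_, fun i hi => ?_, ⟨F.extendXIso e (he 0 (by simp))⟩⟩
  · rw [relAcyclic_quotient_obj_iff]
    intro Y hY i x hx
    obtain hi | ⟨n, rfl⟩ : 0 < i ∨ ∃ n : ℕ, i = -n := by
      by_cases hi : 0 < i
      · exact .inl hi
      · exact .inr ⟨i.natAbs, by lia⟩
    · exact ⟨0, IsZero.eq_of_tgt (CochainComplex.isZero_of_isStrictlyLE _ 0 i) _ _⟩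
    · have hy : ∃ y, y ≫ F.d (n + 1) n = x ≫ (F.extendXIso e (he n rfl)).hom := by
        obtain _ | n := n
        · exact exists_comp_augmentedResolution_d_one_zero C hY _
        · refine exists_comp_augmentedResolution_d C hY n _ ?_
          rw [HomologicalComplex.extend_d_eq _ e (he (n + 1) rfl)
            (he n (by push_cast; lia))] at hx
          simpa [← Category.assoc] using hx
      obtain ⟨y, hy⟩ := hy
      refine ⟨y ≫ (F.extendXIso e (he (n + 1) (by push_cast; lia))).inv, ?_⟩
      rw [HomologicalComplex.extend_d_eq _ e (he (n + 1) (by push_cast; lia)) (he n rfl)]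
      simp [reassoc_of% hy]
  · obtain ⟨n, hn⟩ : ∃ n : ℕ, i = - (n + 1 : ℕ) := ⟨(-i - 1).natAbs, by lia⟩
    exact C.prop_of_iso (F.extendXIso e (he (n + 1) hn)).symm
      (prop_augmentedResolution_X C M n)

lemma exists_relAcyclic [C.IsClosedUnderIsomorphisms] (M : A) (b : ℤ) :
    ∃ (E : CochainComplex A ℤ), E.IsStrictlyLE b ∧
      relAcyclic C ((HomotopyCategory.quotient _ _).obj E) ∧ (∀ i, i < b → C (E.X i)) ∧
        Nonempty (E.X b ≅ M) := by
  obtain ⟨E, h, hE, hC, ⟨e⟩⟩ := exists_relAcyclic_zero C M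
  refine ⟨E⟦-b⟧, E.isStrictlyLE_shift 0 (-b) b (by lia), ?_, fun i hi => hC _ (by lia),
    ⟨E.shiftFunctorObjXIso (-b) b 0 (by lia) ≪≫ e⟩⟩
  exact ObjectProperty.prop_of_iso _
    (((HomotopyCategory.quotient A (.up ℤ)).commShiftIso (-b)).symm.app E)
    ((relAcyclic C).le_shift _ _ hE)

variable [IsResolving C]

/-- Removing the top term `M` of the augmented resolution `E` leaves a complex over `C`; rotating
the triangle exhibits its shift as a resolution of `M` with cone `E`. -/
lemma extensionProduct_single (M : A) (b : ℤ) :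
    (kMinus C).extensionProduct (relAcyclic C)
      ((HomotopyCategory.quotient A (.up ℤ)).obj ((HomologicalComplex.single A _ b).obj M)) := by
  obtain ⟨E, h, hE, hC, ⟨e⟩⟩ := exists_relAcyclic C M b
  obtain ⟨X, f, g, k, hT, h₀, hX⟩ := exists_triangle_single E b
  refine ObjectProperty.prop_of_iso _ ((HomotopyCategory.quotient A (.up ℤ)).mapIso
    ((HomologicalComplex.single A _ b).mapIso e))
    ⟨_, _, _, _, _, inv_rot_of_distTriang _ hT, (kMinus C).le_shift (-1) _ ⟨⟨b, ?_⟩, ?_⟩, hE⟩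
  · refine (CochainComplex.isStrictlyLE_iff _ _).2 fun i hi => ?_
    exact (E.isZero_of_isStrictlyLE b i).of_iso (hX i (by lia)).some.symm
  · intro i
    obtain hi | rfl | hi := lt_trichotomy i b
    · exact C.prop_of_iso (hX i (by lia)).some (hC i hi)
    · exact C.prop_of_isZero h₀
    · exact C.prop_of_isZero ((E.isZero_of_isStrictlyLE b i).of_iso (hX i (by lia)).some.symm)

lemma extensionProduct_of_bounded (X : CochainComplex A ℤ) (a b : ℤ) [X.IsStrictlyGE a]
    [X.IsStrictlyLE b] :
    (kMinus C).extensionProduct (relAcyclic C) ((HomotopyCategory.quotient A (.up ℤ)).obj X) := by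
  -- `k` bounds the number of possibly nonzero degrees; the induction removes the top term.
  obtain ⟨k, hk⟩ : ∃ k : ℕ, b < a + k := ⟨(b + 1 - a).toNat, by lia⟩
  induction k generalizing b X with
  | zero =>
    have hX : IsZero X := by
      rw [IsZero.iff_id_eq_zero]
      ext i
      by_cases hi : i < a
      · exact (X.isZero_of_isStrictlyGE a i).eq_of_src _ _
      · exact (X.isZero_of_isStrictlyLE b i).eq_of_src _ _
    exact ObjectProperty.le_extensionProduct_right _ _
      (ObjectProperty.prop_of_isZero _ (Functor.map_isZero _ hX))
  | succ k hk' =>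
    obtain ⟨X', f, g, h, hT, h₀, hX⟩ := exists_triangle_single X b
    have hz (i : ℤ) (hi : IsZero (X.X i)) : IsZero (X'.X i) := by
      by_cases hib : i = b
      · rwa [hib]
      · exact hi.of_iso (hX i hib).some.symm
    have : X'.IsStrictlyGE a := (CochainComplex.isStrictlyGE_iff _ _).2 fun i hi =>
      hz i (X.isZero_of_isStrictlyGE a i)
    have : X'.IsStrictlyLE (b - 1) := (CochainComplex.isStrictlyLE_iff _ _).2 fun i hi => by
      obtain rfl | hi' : i = b ∨ b < i := by lia
      · exact h₀
      · exact hz i (X.isZero_of_isStrictlyLE b i)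
    exact extensionProduct_extensionProduct_le (kMinus_le_leftOrthogonal C) _
      ⟨_, _, _, _, _, hT, extensionProduct_single C _ b, hk' X' (b - 1) (by lia)⟩

/-- Bounded complexes have proper `C`-resolutions. -/
lemma exists_resolution (X : CochainComplex A ℤ) (a b : ℤ) [X.IsStrictlyGE a]
    [X.IsStrictlyLE b] : ∃ (R : K A) (f : R ⟶ (HomotopyCategory.quotient _ _).obj X),
      kMinusBounded C R ∧ (relAcyclic C).trW f := by
  obtain ⟨R, Z, f, g, h, hT, hR, hZ⟩ := extensionProduct_of_bounded C X a b
  refine ⟨R, f, ⟨hR, ?_⟩, ObjectProperty.trW.mk _ hT hZ⟩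
  refine ObjectProperty.ext_of_isTriangulatedClosed₁ _ _ hT ?_ ?_
  · exact (homBounded_quotient_obj_iff C X).2 ⟨a - 1, fun i hi Y _ => homExactAt_of_isZero _ _ _
      (X.isZero_of_isStrictlyGE a i (by lia))⟩
  · obtain ⟨Z : CochainComplex _ _, rfl⟩ := HomotopyCategory.quotient_obj_surjective Z
    rw [relAcyclic_quotient_obj_iff] at hZ
    exact (homBounded_quotient_obj_iff C Z).2 ⟨0, fun i _ Y hY => hZ Y hY i⟩

end Resolution

end Resolutions

/-! ### Comparison with the bounded derived category. -/

section Comparison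

variable {A : Type u} [Category.{v} A] [Abelian A] (C : ObjectProperty A)

lemma kBoundedAcyclic_le : kBoundedAcyclic C ≤ kMinusBounded C := by
  rintro X ⟨hX, Y, ⟨hY, -⟩, ⟨e⟩⟩
  exact ⟨hX, ObjectProperty.prop_of_iso _ e.symm (kBounded_le_kMinusBounded C _ hY).2⟩

variable [EnoughProjectives A] [IsResolving C]

lemma exists_relAcyclic_trW_πTruncGE {X : CochainComplex A ℤ}
    (hX : kMinusBounded C ((HomotopyCategory.quotient _ _).obj X)) : ∃ m₀ : ℤ, ∀ m ≤ m₀,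
      (relAcyclic C).trW ((HomotopyCategory.quotient _ _).map (X.πTruncGE m)) := by
  obtain ⟨N, hN⟩ := (homBounded_quotient_obj_iff C X).1 hX.2
  -- Truncating at `m` requires Hom-exactness through degree `m + 1`, hence `N - 1`.
  exact ⟨N - 1, fun m hm => relAcyclic_trW_πTruncGE C X m fun i hi => hN i (by lia)⟩

/-- A low truncation is bounded and acyclic with terms in `C`. The truncation map has relatively
acyclic cone and both ends in `K^-(C)`, so it is a homotopy equivalence. -/
lemma kBoundedAcyclic_of_acyclic {X : K A} (hX : kMinusBounded C X)
    (h : HomotopyCategory.subcategoryAcyclic A X) : kBoundedAcyclic C X := by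
  refine ⟨hX.1, ?_⟩
  obtain ⟨X : CochainComplex A ℤ, rfl⟩ := HomotopyCategory.quotient_obj_surjective X
  obtain ⟨m, hm⟩ := exists_relAcyclic_trW_πTruncGE C hX
  obtain ⟨⟨b, hb⟩, hXC⟩ := hX.1
  have : X.IsStrictlyLE b := hb
  rw [HomotopyCategory.quotient_obj_mem_subcategoryAcyclic_iff_acyclic] at h
  have hC := prop_truncGE_X C X b m hXC h
  let X' : K A := (HomotopyCategory.quotient _ _).obj (X.truncGE m)
  have hb' : ∃ b, CochainComplex.IsStrictlyLE X'.as b :=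
    ⟨b, inferInstanceAs ((X.truncGE m).IsStrictlyLE b)⟩
  have : IsIso ((HomotopyCategory.quotient _ _).map (X.πTruncGE m)) :=
    isIso_of_relAcyclic_trW C hX.1 ⟨hb', hC⟩ (hm m le_rfl)
  refine ⟨X', ⟨⟨⟨m, inferInstanceAs ((X.truncGE m).IsStrictlyGE m)⟩, hb', hC⟩, ?_⟩,
    ⟨asIso ((HomotopyCategory.quotient _ _).map (X.πTruncGE m))⟩⟩
  exact (HomotopyCategory.quotient_obj_mem_subcategoryAcyclic_iff_acyclic _).2 (h.truncGE _)

lemma acyclicIn_eq : acyclicIn C =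
    (HomotopyCategory.subcategoryAcyclic A).inverseImage (kMinusBounded C).ι := by
  ext X
  refine ⟨?_, kBoundedAcyclic_of_acyclic C X.property⟩
  rintro ⟨-, Y, ⟨-, hY⟩, ⟨e⟩⟩
  exact (HomotopyCategory.subcategoryAcyclic A).prop_of_iso e.symm hY

lemma isThick_acyclicIn : IsThick (acyclicIn C) where
  isTriangulated := inferInstance
  isStableUnderRetracts := ⟨fun {X Y} r hY => by
    rw [acyclicIn_eq] at hY ⊢
    rw [ObjectProperty.prop_inverseImage_iff, HomotopyCategory.mem_subcategoryAcyclic_iff]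
      at hY ⊢
    intro n
    have r' := r.map ((kMinusBounded C).ι ⋙ HomotopyCategory.homologyFunctor A _ n)
    exact (IsZero.iff_id_eq_zero _).2
      (r'.retract.symm.trans (by rw [(hY n).eq_zero_of_tgt r'.i, zero_comp]))⟩

variable [HasDerivedCategory.{w} A]

lemma isIso_Qh_map_of_relAcyclic_trW {X X' : K A} {s : X ⟶ X'} (hs : (relAcyclic C).trW s) :
    IsIso (DerivedCategory.Qh.map s) := by
  rw [DerivedCategory.isIso_Qh_map_iff, HomotopyCategory.quasiIso_eq_trW_subcategoryAcyclic]
  exact ObjectProperty.trW_monotone (relAcyclic_le_subcategoryAcyclic C) _ hs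

lemma bounded_Qh_obj {X : K A} (hX : kMinusBounded C X) :
    DerivedCategory.TStructure.t.bounded (DerivedCategory.Qh.obj X) := by
  obtain ⟨X : CochainComplex A ℤ, rfl⟩ := HomotopyCategory.quotient_obj_surjective X
  obtain ⟨m, hm⟩ := exists_relAcyclic_trW_πTruncGE C hX
  obtain ⟨⟨b, hb⟩, -⟩ := hX.1
  have : X.IsStrictlyLE b := hb
  have := isIso_Qh_map_of_relAcyclic_trW C (hm m le_rfl)
  let e : DerivedCategory.Q.obj (X.truncGE m) ≅
      DerivedCategory.Qh.obj ((HomotopyCategory.quotient _ _).obj X) :=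
    (DerivedCategory.quotientCompQhIso A).symm.app _ ≪≫
      (asIso (DerivedCategory.Qh.map ((HomotopyCategory.quotient _ _).map (X.πTruncGE m)))).symm
  exact ⟨⟨m, DerivedCategory.TStructure.t.isGE_of_iso e m⟩,
    ⟨b, DerivedCategory.TStructure.t.isLE_of_iso e b⟩⟩

section Fractions

variable [IsContravariantlyFinite C]

/-- Morphisms in the derived category between objects of `K^{-,C,b}(C)` are right fractions
in `K^{-,C,b}(C)`. -/
lemma exists_rightFraction {X Y : K A} (hX : kMinusBounded C X) (hY : kMinusBounded C Y)
    (f : DerivedCategory.Qh.obj X ⟶ DerivedCategory.Qh.obj Y) :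
    ∃ (R : K A) (_ : kMinusBounded C R) (t : R ⟶ X) (u : R ⟶ Y),
      IsIso (DerivedCategory.Qh.map t) ∧
        DerivedCategory.Qh.map t ≫ f = DerivedCategory.Qh.map u := by
  obtain ⟨X : CochainComplex A ℤ, rfl⟩ := HomotopyCategory.quotient_obj_surjective X
  obtain ⟨Y : CochainComplex A ℤ, rfl⟩ := HomotopyCategory.quotient_obj_surjective Y
  obtain ⟨m₁, h₁⟩ := exists_relAcyclic_trW_πTruncGE C hX
  obtain ⟨m₂, h₂⟩ := exists_relAcyclic_trW_πTruncGE C hY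
  obtain ⟨⟨b, hb⟩, -⟩ := hX.1
  have : X.IsStrictlyLE b := hb
  let m := min m₁ m₂
  let q := HomotopyCategory.quotient A (ComplexShape.up ℤ)
  let Q : K A ⥤ DerivedCategory A := DerivedCategory.Qh
  let p : q.obj X ⟶ q.obj (X.truncGE m) := q.map (X.πTruncGE m)
  let p' : q.obj Y ⟶ q.obj (Y.truncGE m) := q.map (Y.πTruncGE m)
  have hp : (relAcyclic C).trW p := h₁ m (by lia)
  have hp' : (relAcyclic C).trW p' := h₂ m (by lia)
  have hQp : IsIso (Q.map p) := isIso_Qh_map_of_relAcyclic_trW C hp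
  have hQp' : IsIso (Q.map p') := isIso_Qh_map_of_relAcyclic_trW C hp'
  let f' : Q.obj (q.obj (X.truncGE m)) ⟶ Q.obj (q.obj (Y.truncGE m)) :=
    inv (Q.map p) ≫ f ≫ Q.map p'
  -- The denominator `Z` lives in degrees `[m, b]`, so it has a resolution, whose maps to the two
  -- truncations lift to `X` and `Y`.
  obtain ⟨Z, _, _, s, hs, g, fac⟩ :=
    DerivedCategory.right_fac_of_isStrictlyLE_of_isStrictlyGE (X := X.truncGE m)
      (Y := Y.truncGE m) m b f'
  obtain ⟨R, r, hR, hr⟩ := exists_resolution C Z m b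
  obtain ⟨t, ht⟩ := exists_lift C hR.1 hp (r ≫ q.map s)
  obtain ⟨u, hu⟩ := exists_lift C hR.1 hp' (r ≫ q.map g)
  have hs' : IsIso (Q.map (q.map s)) := hs
  have : IsIso (Q.map r) := isIso_Qh_map_of_relAcyclic_trW C hr
  have htp : Q.map t ≫ Q.map p = Q.map r ≫ Q.map (q.map s) := by
    rw [← Q.map_comp, ht, Q.map_comp]
  have hup : Q.map u ≫ Q.map p' = Q.map r ≫ Q.map (q.map g) := by
    rw [← Q.map_comp, hu, Q.map_comp]
  have fac' : Q.map (q.map s) ≫ inv (Q.map p) ≫ f ≫ Q.map p' = Q.map (q.map g) := by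
    refine (congrArg (fun z => Q.map (q.map s) ≫ z) fac).trans ?_
    exact IsIso.hom_inv_id_assoc _ _
  refine ⟨R, hR, t, u, ?_, ?_⟩
  · have : IsIso (Q.map t ≫ Q.map p) := by rw [htp]; infer_instance
    exact IsIso.of_isIso_comp_right (Q.map t) (Q.map p)
  · change Q.map t ≫ f = Q.map u
    rw [← cancel_mono (Q.map p'), hup, ← fac', ← reassoc_of% htp, IsIso.hom_inv_id_assoc,
      Category.assoc]

end Fractions

/-- The functor from `K^{-,C,b}(C)` to the bounded derived category. -/
noncomputable def toBounded : (kMinusBounded C).FullSubcategory ⥤ DerivedCategory.Bounded A :=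
  DerivedCategory.TStructure.t.bounded.lift ((kMinusBounded C).ι ⋙ DerivedCategory.Qh)
    fun X => bounded_Qh_obj C X.property

noncomputable instance : (toBounded C).CommShift ℤ := by
  dsimp only [toBounded]
  infer_instance

instance : (toBounded C).IsTriangulated :=
  inferInstanceAs (DerivedCategory.TStructure.t.bounded.lift
    ((kMinusBounded C).ι ⋙ DerivedCategory.Qh)
    fun X => bounded_Qh_obj C X.property).IsTriangulated

lemma isIso_toBounded_map_iff {X Y : (kMinusBounded C).FullSubcategory} (f : X ⟶ Y) :
    IsIso ((toBounded C).map f) ↔ (acyclicIn C).trW f := by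
  have h₁ : IsIso ((toBounded C).map f) ↔ IsIso (DerivedCategory.Qh.map f.hom) :=
    ⟨fun _ => inferInstanceAs
      (IsIso (DerivedCategory.TStructure.t.bounded.ι.map ((toBounded C).map f))),
      fun h => by
        have : IsIso (DerivedCategory.TStructure.t.bounded.ι.map ((toBounded C).map f)) := h
        exact isIso_of_fully_faithful DerivedCategory.TStructure.t.bounded.ι _⟩
  obtain ⟨Z, g, h, hT⟩ := distinguished_cocone_triangle f
  rw [h₁, DerivedCategory.isIso_Qh_map_iff, HomotopyCategory.quasiIso_eq_trW_subcategoryAcyclic,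
    acyclicIn_eq]
  exact ((HomotopyCategory.subcategoryAcyclic A).trW_iff_of_distinguished _
    ((kMinusBounded C).ι.map_distinguished _ hT)).trans
      (((HomotopyCategory.subcategoryAcyclic A).inverseImage
        (kMinusBounded C).ι).trW_iff_of_distinguished _ hT).symm

lemma toBounded_inverts : (acyclicIn C).trW.IsInvertedBy (toBounded C) :=
  fun _ _ f hf => (isIso_toBounded_map_iff C f).2 hf

/-- The functor from the Verdier quotient to the bounded derived category. -/
noncomputable def quotientToBounded : RelQuotient C ⥤ DerivedCategory.Bounded A :=
  Localization.lift (toBounded C) (toBounded_inverts C) (relQuotientFunctor C)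

noncomputable instance : Localization.Lifting (relQuotientFunctor C) (acyclicIn C).trW
    (toBounded C) (quotientToBounded C) :=
  inferInstanceAs (Localization.Lifting (acyclicIn C).trW.Q (acyclicIn C).trW
    (toBounded C) (Localization.lift _ _ _))

/-- The functor `quotientToBounded` extends `toBounded`. -/
noncomputable def quotientCompQuotientToBoundedIso :
    relQuotientFunctor C ⋙ quotientToBounded C ≅ toBounded C :=
  Localization.Lifting.iso (relQuotientFunctor C) (acyclicIn C).trW _ _

noncomputable instance instCommShiftQuotientToBounded : (quotientToBounded C).CommShift ℤ :=
  Functor.commShiftOfLocalization (relQuotientFunctor C) (acyclicIn C).trW ℤ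
    (toBounded C) (quotientToBounded C)

instance : NatTrans.CommShift (quotientCompQuotientToBoundedIso C).hom ℤ :=
  NatTrans.commShift_iso_hom_of_localization (relQuotientFunctor C) (acyclicIn C).trW ℤ
    (toBounded C) (quotientToBounded C)

/-- Lets triangulatedness descend from `toBounded` to the quotient. -/
instance : (relQuotientFunctor C).mapArrow.EssSurj :=
  Localization.essSurj_mapArrow _ (acyclicIn C).trW

instance isTriangulated_quotientToBounded : (quotientToBounded C).IsTriangulated :=
  Functor.isTriangulated_of_precomp_iso (quotientCompQuotientToBoundedIso C)

section Equivalence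

variable [IsContravariantlyFinite C]

lemma exists_toBounded_rightFraction {X Y : (kMinusBounded C).FullSubcategory}
    (f : (toBounded C).obj X ⟶ (toBounded C).obj Y) :
    ∃ (R : (kMinusBounded C).FullSubcategory) (t : R ⟶ X) (u : R ⟶ Y),
      (acyclicIn C).trW t ∧ (toBounded C).map t ≫ f = (toBounded C).map u := by
  obtain ⟨R, hR, t, u, ht, fac⟩ := exists_rightFraction C X.property Y.property
    (DerivedCategory.TStructure.t.bounded.ι.map f)
  refine ⟨⟨R, hR⟩, (kMinusBounded C).homMk t, (kMinusBounded C).homMk u, ?_, ?_⟩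
  · rw [← isIso_toBounded_map_iff]
    have : IsIso (DerivedCategory.TStructure.t.bounded.ι.map
      ((toBounded C).map ((kMinusBounded C).homMk t : ⟨R, hR⟩ ⟶ X))) := ht
    exact isIso_of_fully_faithful DerivedCategory.TStructure.t.bounded.ι _
  · exact DerivedCategory.TStructure.t.bounded.ι.map_injective fac

instance : (toBounded C).EssSurj where
  mem_essImage := by
    rintro ⟨X, ⟨⟨a, ha⟩, ⟨b, hb⟩⟩⟩
    have : X.IsGE a := ha
    have : X.IsLE b := hb
    obtain ⟨Z, _, _, ⟨e⟩⟩ := X.exists_iso_Q_obj_of_isGE_of_isLE a b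
    obtain ⟨R, r, hR, hr⟩ := exists_resolution C Z a b
    have : IsIso (DerivedCategory.Qh.map r) := isIso_Qh_map_of_relAcyclic_trW C hr
    let e' := asIso (DerivedCategory.Qh.map r)
    exact ⟨⟨R, hR⟩, ⟨DerivedCategory.TStructure.t.bounded.ι.preimageIso
      (e' ≪≫
        (DerivedCategory.quotientCompQhIso A).app Z ≪≫ e.symm)⟩⟩

instance : (quotientToBounded C).EssSurj where
  mem_essImage Y := ⟨_, ⟨(quotientCompQuotientToBoundedIso C).app _ ≪≫
    (toBounded C).objObjPreimageIso Y⟩⟩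

instance : (relQuotientFunctor C).EssSurj :=
  Localization.essSurj _ (acyclicIn C).trW

instance : (quotientToBounded C).Full := by
  refine Functor.full_of_comp_essSurj _ (relQuotientFunctor C) fun X Y φ => ?_
  let e := quotientCompQuotientToBoundedIso C
  obtain ⟨R, t, u, ht, fac⟩ := exists_toBounded_rightFraction C
    (e.inv.app X ≫ φ ≫ e.hom.app Y)
  have := Localization.inverts (relQuotientFunctor C) (acyclicIn C).trW t ht
  refine ⟨inv ((relQuotientFunctor C).map t) ≫ (relQuotientFunctor C).map u, ?_⟩
  rw [← cancel_epi ((quotientToBounded C).map ((relQuotientFunctor C).map t)),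
    ← Functor.map_comp, IsIso.hom_inv_id_assoc, ← cancel_mono (e.hom.app Y)]
  have h₁ := e.hom.naturality u
  have h₂ := e.hom.naturality t
  dsimp at h₁ h₂
  rw [h₁, ← fac, ← reassoc_of% h₂]
  simp

instance : (quotientToBounded C).Additive := by
  rw [Localization.functor_additive_iff (relQuotientFunctor C) (acyclicIn C).trW]
  exact Functor.additive_of_iso (quotientCompQuotientToBoundedIso C).symm

instance : (quotientToBounded C).Faithful := by
  refine Functor.faithful_of_comp_cancel_zero_of_hasLeftCalculusOfFractions
    (relQuotientFunctor C) (acyclicIn C).trW _ fun X Y f hf => ?_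
  have hf' : (toBounded C).map f = 0 := by
    rw [← NatIso.naturality_1 (quotientCompQuotientToBoundedIso C) f, Functor.comp_map, hf]
    simp
  -- By the calculus of fractions it suffices to treat morphisms `f` of `K^{-,C,b}(C)`. Since `f`
  -- dies in the derived category, the image of `a` has a section `σ`. Writing `σ` as a fraction
  -- makes `u ≫ a` invertible in the quotient, while `a ≫ f = 0`.
  obtain ⟨W, a, c, hT⟩ := distinguished_cocone_triangle₁ f
  obtain ⟨σ, hσ⟩ : ∃ σ : (toBounded C).obj X ⟶ (toBounded C).obj W,
      𝟙 _ = σ ≫ (toBounded C).map a :=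
    Triangle.coyoneda_exact₂ _ ((toBounded C).map_distinguished _ hT) (𝟙 _)
      ((congrArg (𝟙 _ ≫ ·) hf').trans comp_zero)
  obtain ⟨R, t, u, ht, fac⟩ := exists_toBounded_rightFraction C σ
  have hua : (acyclicIn C).trW (u ≫ a) := by
    rw [← isIso_toBounded_map_iff] at ht ⊢
    have : (toBounded C).map (u ≫ a) = (toBounded C).map t := by
      rw [Functor.map_comp, ← fac, Category.assoc, ← hσ, Category.comp_id]
    rwa [this]
  have := Localization.inverts (relQuotientFunctor C) (acyclicIn C).trW _ hua
  have haf : a ≫ f = 0 := comp_distTriang_mor_zero₁₂ _ hT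
  rw [← cancel_epi ((relQuotientFunctor C).map (u ≫ a)), ← Functor.map_comp, Category.assoc, haf,
    comp_zero, comp_zero, Functor.map_zero]

instance : (quotientToBounded C).IsEquivalence where

end Equivalence

end Comparison

end RelDer

theorem proposition3p3 {A : Type u} [Category.{v} A] [Abelian A] [EnoughProjectives A]
    [HasDerivedCategory.{w} A] (C : ObjectProperty A) [RelDer.IsResolving C]
    [RelDer.IsContravariantlyFinite C] :
    RelDer.kBoundedAcyclic C ≤ RelDer.kMinusBounded C ∧
    RelDer.IsThick (RelDer.acyclicIn C) ∧
    ∃ (e : RelDer.RelQuotient C ≌ DerivedCategory.Bounded A) (_ : e.functor.CommShift ℤ),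
      e.functor.IsTriangulated ∧
      Nonempty (RelDer.kBoundedInclusion C ⋙ RelDer.relQuotientFunctor C ⋙ e.functor ⋙
        DerivedCategory.Bounded.ι ≅ (RelDer.kBounded C).ι ⋙ DerivedCategory.Qh) :=
  ⟨RelDer.kBoundedAcyclic_le C, RelDer.isThick_acyclicIn C,
    (RelDer.quotientToBounded C).asEquivalence,
    RelDer.instCommShiftQuotientToBounded C, RelDer.isTriangulated_quotientToBounded C,
    -- Whiskering suffices: `toBounded` followed by the inclusion is by construction `Qh` on
    -- `K^{-,C,b}(C)`.
    ⟨Functor.isoWhiskerLeft (RelDer.kBoundedInclusion C)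
      (Functor.isoWhiskerRight (RelDer.quotientCompQuotientToBoundedIso C)
        DerivedCategory.Bounded.ι)⟩⟩
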